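/- Conventions. Via the bijective code $(a,b)\mapsto \frac{b(b-1)}2+a$ of the pairs $a<b$, a function $e:\mathbb N\to\mathbb N$ codes the graph $G$ on $\mathbb N$ in which $a<b$ are adjacent if and only if $e$ is nonzero at the code of $(a,b)$; $G_m$ is the subgraph of $G$ on the vertices $0,\dots,m$. A $k$-coloring of $G$ is an $f:\mathbb N\to\{0,\dots,k-1\}$ that gives adjacent vertices different values. $\mathsf{GC}k$ is the problem whose inputs are the $e$ such that every $G_m$ has a $k$-coloring, and whose solutions are the $k$-colorings $f$ of $G$. $\mathsf{TGC}k$ is the problem whose inputs are all $e$, and whose solutions are the $f:\mathbb N\to\mathbb N$ such that $f(0)=0$ implies that $f$ is a $k$-coloring of $G$, and $f(0)>0$ implies that $G_{f(0)}$ has no $k$-coloring. $i\mathsf{RCA}_0^\omega$ is the intuitionistic theory in all finite types with equality at type $0$ (higher-type equality is defined extensionally), extensionality at all types, the successor axioms, the typed combinators, the recursor of type $0$, induction for quantifier-free formulas, and the schema $\mathsf{QF}\text{-}\mathsf{AC}^{1,0}$: $\forall x^1\exists y^0 A(x,y)\to\exists Y^{1\to0}\forall x^1 A(x,Y(x))$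 for quantifier-free $A$. In its language, a problem is given by formulas $p_1(x)$ ("$x$ is an input") and $p_2(x,y)$ ("$y$ is a solution of $x$") with $x,y$ of type $1$, and, for problems $\mathsf Q=(q_1,q_2)$ and $\mathsf P=(p_1,p_2)$, $\mathsf Q\le_W\mathsf P$ stands for the sentence $$\exists \Phi^{1\to1}\,\exists \Psi^{1\to1}\,\forall u\,\forall y\,\bigl(q_1(u)\to(p_1(\Phi(u))\land(p_2(\Phi(u),y)\to q_2(u,\Psi(y))))\bigr).$$ $\mathsf{GC}k$ and $\mathsf{TGC}k$ are given by the $\exists$-free formulas that transcribe the definitions above, for the numeral $k$; there "$G_m$ has a $k$-coloring" is written $c(e,m)=1$ and "$G_m$ has no $k$-coloring" is written $c(e,m)=0$, where $c$ is a closed term for the primitive recursive $0$-$1$-valued characteristic functional of $k$-colorability of $G_m$. In the non-formal setting, $\mathsf Q\le_W\mathsf P$ means that there are computable partial functions $\Phi,\Psi$ on Baire space $\mathbb N^{\mathbb N}$ such that, for every input $u$ of $\mathsf Q$, $\Phi(u)$ is defined and is an input of $\mathsf P$, and, for every solution $y$ of $\Phi(u)$ for $\mathsf P$, $\Psi(\langle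 u,y\rangle)$ is defined and is a solution of $u$ for $\mathsf Q$. $\mathsf Q<_W\mathsf P$ means $\mathsf Q\le_W\mathsf P$ and $\mathsf P\not\le_W\mathsf Q$. Statement. For every natural number $k\ge2$: (1) $i\mathsf{RCA}_0^\omega\vdash \mathsf{GC}k\le_W\mathsf{TGC}k$; (2) in the non-formal setting, $\mathsf{GC}k<_W\mathsf{TGC}k$. -/

import Mathlib

/-! ### Finite types, terms and formulas -/

namespace IRCA

/-- The finite types: `nat` is type `0` and `σ ⇒ τ` is the type of functionals from `σ` to `τ`. -/
inductive FType : Type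
  | nat : FType
  | arrow : FType → FType → FType

local infixr:60 " ⇒ " => FType.arrow

/-- Type `1`, i.e. `0 → 0`. -/
abbrev FType.one : FType := FType.nat ⇒ FType.nat

open FType

/-- Contexts: the types of the free variables (de Bruijn). -/
abbrev Ctx : Type := List FType

inductive Var : Ctx → FType → Type
  | here {Γ : Ctx} {σ : FType} : Var (σ :: Γ) σ
  | there {Γ : Ctx} {σ τ : FType} : Var Γ τ → Var (σ :: Γ) τ

/-- Terms of finite type over zero, successor, the typed combinators `K` (projector) and
`S` (substitutor), and the recursor `R₀` of type `0`. -/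
inductive Term (Γ : Ctx) : FType → Type
  | var {τ : FType} : Var Γ τ → Term Γ τ
  | zero : Term Γ nat
  | succ : Term Γ (nat ⇒ nat)
  | K (σ τ : FType) : Term Γ (σ ⇒ τ ⇒ σ)
  | S (ρ σ τ : FType) : Term Γ ((ρ ⇒ σ ⇒ τ) ⇒ (ρ ⇒ σ) ⇒ ρ ⇒ τ)
  | recursor : Term Γ (nat ⇒ nat ⇒ (nat ⇒ nat ⇒ nat) ⇒ nat)
  | app {σ τ : FType} : Term Γ (σ ⇒ τ) → Term Γ σ → Term Γ τ

local infixl:70 " ⬝ " => Term.app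

/-- Simultaneous substitutions. -/
abbrev Sub (Γ Δ : Ctx) : Type := ∀ τ : FType, Var Γ τ → Term Δ τ

def Term.subst {Γ Δ : Ctx} (θ : Sub Γ Δ) : {τ : FType} → Term Γ τ → Term Δ τ
  | _, .var x => θ _ x
  | _, .zero => .zero
  | _, .succ => .succ
  | _, .K σ τ => .K σ τ
  | _, .S ρ σ τ => .S ρ σ τ
  | _, .recursor => .recursor
  | _, .app f a => .app (f.subst θ) (a.subst θ)

/-- The substitution of `t` for the most recent variable, and `θ` for the others. -/
def Sub.cons {Γ Δ : Ctx} {σ : FType} (t : Term Δ σ) (θ : Sub Γ Δ) : Sub (σ :: Γ) Δ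
  | _, .here => t
  | _, .there x => θ _ x

def Sub.empty (Γ : Ctx) : Sub [] Γ := nofun

def Sub.weaken (Γ : Ctx) (σ : FType) : Sub Γ (σ :: Γ) := fun _ x => .var (.there x)

abbrev Term.weaken {Γ : Ctx} {σ τ : FType} (t : Term Γ τ) : Term (σ :: Γ) τ :=
  t.subst (Sub.weaken Γ σ)

def Sub.lift {Γ Δ : Ctx} (θ : Sub Γ Δ) (σ : FType) : Sub (σ :: Γ) (σ :: Δ) :=
  Sub.cons (.var .here) (fun _ x => (θ _ x).weaken)

/-- Replace the most recent variable by `t`. -/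
def Sub.single {Γ : Ctx} {σ : FType} (t : Term Γ σ) : Sub (σ :: Γ) Γ :=
  Sub.cons t (fun _ x => .var x)

/-- The only prime formulas besides `⊥` are equations of type `0`. -/
inductive Formula : Ctx → Type
  | eq {Γ : Ctx} : Term Γ nat → Term Γ nat → Formula Γ
  | falsum {Γ : Ctx} : Formula Γ
  | and {Γ : Ctx} : Formula Γ → Formula Γ → Formula Γ
  | or {Γ : Ctx} : Formula Γ → Formula Γ → Formula Γ
  | imp {Γ : Ctx} : Formula Γ → Formula Γ → Formula Γ
  | all {Γ : Ctx} (σ : FType) : Formula (σ :: Γ) → Formula Γ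
  | ex {Γ : Ctx} (σ : FType) : Formula (σ :: Γ) → Formula Γ

namespace Formula

abbrev neg {Γ : Ctx} (φ : Formula Γ) : Formula Γ := imp φ falsum

abbrev verum {Γ : Ctx} : Formula Γ := imp falsum falsum

def subst : {Γ Δ : Ctx} → Sub Γ Δ → Formula Γ → Formula Δ
  | _, _, θ, eq s t => eq (s.subst θ) (t.subst θ)
  | _, _, _, falsum => falsum
  | _, _, θ, and φ ψ => and (φ.subst θ) (ψ.subst θ)
  | _, _, θ, or φ ψ => or (φ.subst θ) (ψ.subst θ)
  | _, _, θ, imp φ ψ => imp (φ.subst θ) (ψ.subst θ)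
  | _, _, θ, all σ φ => all σ (φ.subst (θ.lift σ))
  | _, _, θ, ex σ φ => ex σ (φ.subst (θ.lift σ))

abbrev weaken {Γ : Ctx} {σ : FType} (φ : Formula Γ) : Formula (σ :: Γ) :=
  φ.subst (Sub.weaken Γ σ)

/-- `φ[t]` for the most recent variable. -/
abbrev inst {Γ : Ctx} {σ : FType} (φ : Formula (σ :: Γ)) (t : Term Γ σ) : Formula Γ :=
  φ.subst (Sub.single t)

def QuantifierFree : {Γ : Ctx} → Formula Γ → Prop
  | _, eq _ _ => True
  | _, falsum => True
  | _, and φ ψ => φ.QuantifierFree ∧ ψ.QuantifierFree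
  | _, or φ ψ => φ.QuantifierFree ∧ ψ.QuantifierFree
  | _, imp φ ψ => φ.QuantifierFree ∧ ψ.QuantifierFree
  | _, all _ _ => False
  | _, ex _ _ => False

/-- Equality at an arbitrary finite type: extensional, reduced to equality of type `0`. -/
def eqAt : {Γ : Ctx} → (τ : FType) → Term Γ τ → Term Γ τ → Formula Γ
  | _, .nat, s, t => eq s t
  | _, .arrow σ τ, s, t => all σ (eqAt τ (s.weaken ⬝ .var .here) (t.weaken ⬝ .var .here))

end Formula

open Formula

/-! ### The theory `iRCA₀^ω` -/

/-- `x ↦ S x` for the most recent variable `x`. -/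
def Sub.step (Γ : Ctx) : Sub (nat :: Γ) (nat :: Γ) :=
  Sub.cons (.succ ⬝ .var .here) (fun _ x => .var (.there x))

/-- `A(x, y) ↦ A(x, Y x)`, where the variables of the source are `y, x, …` and those of the
target are `x, Y, …`. -/
def Sub.choice (Γ : Ctx) : Sub (nat :: one :: Γ) (one :: (one ⇒ nat) :: Γ) :=
  Sub.cons (.var (.there .here) ⬝ .var .here)
    (Sub.cons (.var .here) (fun _ x => .var (.there (.there x))))

/-- The non-logical part of `iRCA₀^ω`: equality at type `0`, extensionality at all types,
the successor, the combinators, recursion of type `0`, induction for quantifier-free formulas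
(these make up the system `E-HA^ω` with restricted recursion and induction) and the
quantifier-free choice schema `QF-AC^{1,0}`. All schemata allow parameters of every type. -/
inductive Postulate : {Γ : Ctx} → Formula Γ → Prop
  | eqRefl {Γ : Ctx} (t : Term Γ nat) : Postulate (eq t t)
  | eqSymm {Γ : Ctx} (s t : Term Γ nat) : Postulate (imp (eq s t) (eq t s))
  | eqTrans {Γ : Ctx} (r s t : Term Γ nat) :
      Postulate (imp (eq r s) (imp (eq s t) (eq r t)))
  | ext {Γ : Ctx} {σ τ : FType} (f : Term Γ (σ ⇒ τ)) (a b : Term Γ σ) :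
      Postulate (imp (eqAt σ a b) (eqAt τ (f ⬝ a) (f ⬝ b)))
  | succNeZero {Γ : Ctx} (t : Term Γ nat) : Postulate (neg (eq (.succ ⬝ t) .zero))
  | succInj {Γ : Ctx} (s t : Term Γ nat) :
      Postulate (imp (eq (.succ ⬝ s) (.succ ⬝ t)) (eq s t))
  | combK {Γ : Ctx} {σ τ : FType} (a : Term Γ σ) (b : Term Γ τ) :
      Postulate (eqAt σ (.K σ τ ⬝ a ⬝ b) a)
  | combS {Γ : Ctx} {ρ σ τ : FType} (a : Term Γ (ρ ⇒ σ ⇒ τ)) (b : Term Γ (ρ ⇒ σ))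
      (c : Term Γ ρ) : Postulate (eqAt τ (.S ρ σ τ ⬝ a ⬝ b ⬝ c) (a ⬝ c ⬝ (b ⬝ c)))
  | recZero {Γ : Ctx} (y : Term Γ nat) (z : Term Γ (nat ⇒ nat ⇒ nat)) :
      Postulate (eq (.recursor ⬝ .zero ⬝ y ⬝ z) y)
  | recSucc {Γ : Ctx} (x y : Term Γ nat) (z : Term Γ (nat ⇒ nat ⇒ nat)) :
      Postulate (eq (.recursor ⬝ (.succ ⬝ x) ⬝ y ⬝ z) (z ⬝ (.recursor ⬝ x ⬝ y ⬝ z) ⬝ x))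
  | induction {Γ : Ctx} (A : Formula (nat :: Γ)) (hA : A.QuantifierFree) :
      Postulate (imp (and (A.inst .zero) (all nat (imp A (A.subst (Sub.step Γ))))) (all nat A))
  | choice {Γ : Ctx} (A : Formula (nat :: one :: Γ)) (hA : A.QuantifierFree) :
      Postulate (imp (all one (ex nat A))
        (ex (one ⇒ nat) (all one (A.subst (Sub.choice Γ)))))

/-- Intuitionistic many-sorted natural deduction over the postulates of `iRCA₀^ω`:
`Deriv H φ` says that `φ` is derivable from the open assumptions `H`. -/
inductive Deriv : {Γ : Ctx} → List (Formula Γ) → Formula Γ → Prop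
  | post {Γ : Ctx} {H : List (Formula Γ)} {φ : Formula Γ} : Postulate φ → Deriv H φ
  | hyp {Γ : Ctx} {H : List (Formula Γ)} {φ : Formula Γ} : φ ∈ H → Deriv H φ
  | falsumElim {Γ : Ctx} {H : List (Formula Γ)} {φ : Formula Γ} :
      Deriv H falsum → Deriv H φ
  | andIntro {Γ : Ctx} {H : List (Formula Γ)} {φ ψ : Formula Γ} :
      Deriv H φ → Deriv H ψ → Deriv H (and φ ψ)
  | andLeft {Γ : Ctx} {H : List (Formula Γ)} {φ ψ : Formula Γ} :
      Deriv H (and φ ψ) → Deriv H φ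
  | andRight {Γ : Ctx} {H : List (Formula Γ)} {φ ψ : Formula Γ} :
      Deriv H (and φ ψ) → Deriv H ψ
  | orInl {Γ : Ctx} {H : List (Formula Γ)} {φ ψ : Formula Γ} :
      Deriv H φ → Deriv H (or φ ψ)
  | orInr {Γ : Ctx} {H : List (Formula Γ)} {φ ψ : Formula Γ} :
      Deriv H ψ → Deriv H (or φ ψ)
  | orElim {Γ : Ctx} {H : List (Formula Γ)} {φ ψ χ : Formula Γ} :
      Deriv H (or φ ψ) → Deriv (φ :: H) χ → Deriv (ψ :: H) χ → Deriv H χ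
  | impIntro {Γ : Ctx} {H : List (Formula Γ)} {φ ψ : Formula Γ} :
      Deriv (φ :: H) ψ → Deriv H (imp φ ψ)
  | impElim {Γ : Ctx} {H : List (Formula Γ)} {φ ψ : Formula Γ} :
      Deriv H (imp φ ψ) → Deriv H φ → Deriv H ψ
  | allIntro {Γ : Ctx} {H : List (Formula Γ)} {σ : FType} {φ : Formula (σ :: Γ)} :
      Deriv (H.map Formula.weaken) φ → Deriv H (all σ φ)
  | allElim {Γ : Ctx} {H : List (Formula Γ)} {σ : FType} {φ : Formula (σ :: Γ)} :
      Deriv H (all σ φ) → (t : Term Γ σ) → Deriv H (φ.inst t)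
  | exIntro {Γ : Ctx} {H : List (Formula Γ)} {σ : FType} {φ : Formula (σ :: Γ)}
      (t : Term Γ σ) : Deriv H (φ.inst t) → Deriv H (ex σ φ)
  | exElim {Γ : Ctx} {H : List (Formula Γ)} {σ : FType} {φ : Formula (σ :: Γ)}
      {ψ : Formula Γ} :
      Deriv H (ex σ φ) → Deriv (φ :: H.map Formula.weaken) ψ.weaken → Deriv H ψ

/-- `iRCA₀^ω ⊢ φ` for a sentence `φ`. -/
def Provable (φ : Formula []) : Prop := Deriv [] φ

/-! ### Formalized problems and formalized Weihrauch reducibility -/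

/-- The substitution of `x` for the only variable. -/
def Sub.one {Γ : Ctx} {σ : FType} (x : Term Γ σ) : Sub [σ] Γ := Sub.cons x (Sub.empty Γ)

/-- The substitution of `x` for the outer and of `y` for the inner variable. -/
def Sub.two {Γ : Ctx} {σ τ : FType} (x : Term Γ σ) (y : Term Γ τ) : Sub [τ, σ] Γ :=
  Sub.cons y (Sub.one x)

/-- A problem `∀ x (dom(x) → ∃ y sol(x, y))` with `x`, `y` of type `1`, given by its two formulas.
In `sol` the variable `here` is the solution `y` and `there here` is the input `x`. -/
structure FormalProblem : Type where
  dom : Formula [one]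
  sol : Formula [one, one]

/-- The sentence formalizing `Q ≤_W P`:
`∃ Φ ∃ Ψ ∀ u ∀ y (Q.dom(u) → (P.dom(Φ u) ∧ (P.sol(Φ u, y) → Q.sol(u, Ψ y))))`
with `Φ`, `Ψ` of type `1 → 1`. -/
def reduction (Q P : FormalProblem) : Formula [] :=
  let Φ : Term [one, one, one ⇒ one, one ⇒ one] (one ⇒ one) :=
    .var (.there (.there (.there .here)))
  let Ψ : Term [one, one, one ⇒ one, one ⇒ one] (one ⇒ one) := .var (.there (.there .here))
  let u : Term [one, one, one ⇒ one, one ⇒ one] one := .var (.there .here)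
  let y : Term [one, one, one ⇒ one, one ⇒ one] one := .var .here
  ex (one ⇒ one) (ex (one ⇒ one) (all one (all one
    (imp (Q.dom.subst (Sub.one u))
      (and (P.dom.subst (Sub.one (Φ ⬝ u)))
        (imp (P.sol.subst (Sub.two (Φ ⬝ u) y)) (Q.sol.subst (Sub.two u (Ψ ⬝ y)))))))))

/-! ### Primitive recursive terms -/

/-- Lambda abstraction through the combinators. -/
def Term.lam {Γ : Ctx} {σ : FType} : {τ : FType} → Term (σ :: Γ) τ → Term Γ (σ ⇒ τ)
  | _, .var .here => .S σ (σ ⇒ σ) σ ⬝ .K σ (σ ⇒ σ) ⬝ .K σ σ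
  | _, .var (.there x) => .K _ σ ⬝ .var x
  | _, .zero => .K _ σ ⬝ .zero
  | _, .succ => .K _ σ ⬝ .succ
  | _, .K α β => .K _ σ ⬝ .K α β
  | _, .S α β γ => .K _ σ ⬝ .S α β γ
  | _, .recursor => .K _ σ ⬝ .recursor
  | _, .app f a => .S σ _ _ ⬝ f.lam ⬝ a.lam

/-- A closed term in an arbitrary context. -/
def Term.closed {Γ : Ctx} {τ : FType} (t : Term [] τ) : Term Γ τ :=
  t.subst (Sub.empty Γ)

section PrimitiveRecursive

open Term

local notation "v₀" => Term.var Var.here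
local notation "v₁" => Term.var (Var.there Var.here)
local notation "v₂" => Term.var (Var.there (Var.there Var.here))
local notation "v₃" => Term.var (Var.there (Var.there (Var.there Var.here)))
local notation "v₄" => Term.var (Var.there (Var.there (Var.there (Var.there Var.here))))

def numeral {Γ : Ctx} : ℕ → Term Γ nat
  | 0 => zero
  | n + 1 => succ ⬝ numeral n

/-- `a + b`: `r ↦ S r`, iterated `b` times from `a`. -/
def addT : Term [] (nat ⇒ nat ⇒ nat) :=
  lam (lam (recursor ⬝ v₀ ⬝ v₁ ⬝ lam (lam (succ ⬝ v₁))))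

/-- `a * b`: `r ↦ r + a`, iterated `b` times from `0`. -/
def mulT : Term [] (nat ⇒ nat ⇒ nat) :=
  lam (lam (recursor ⬝ v₀ ⬝ zero ⬝ lam (lam (addT.closed ⬝ v₁ ⬝ v₃))))

/-- `a ^ b`: `r ↦ r * a`, iterated `b` times from `1`. -/
def powT : Term [] (nat ⇒ nat ⇒ nat) :=
  lam (lam (recursor ⬝ v₀ ⬝ numeral 1 ⬝ lam (lam (mulT.closed ⬝ v₁ ⬝ v₃))))

/-- The predecessor, with value `0` at `0`. -/
def predT : Term [] (nat ⇒ nat) :=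
  lam (recursor ⬝ v₀ ⬝ zero ⬝ lam (lam v₀))

/-- Truncated subtraction `a ∸ b`. -/
def subT : Term [] (nat ⇒ nat ⇒ nat) :=
  lam (lam (recursor ⬝ v₀ ⬝ v₁ ⬝ lam (lam (predT.closed ⬝ v₁))))

/-- `1` at `0`, and `0` elsewhere. -/
def isZeroT : Term [] (nat ⇒ nat) :=
  lam (subT.closed ⬝ numeral 1 ⬝ v₀)

/-- `0` at `0`, and `1` elsewhere. -/
def signT : Term [] (nat ⇒ nat) :=
  lam (isZeroT.closed ⬝ (isZeroT.closed ⬝ v₀))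

/-- The remainder of `a` modulo `b`. -/
def modT : Term [] (nat ⇒ nat ⇒ nat) :=
  lam (lam (recursor ⬝ v₁ ⬝ zero ⬝ lam (lam
    (mulT.closed ⬝ (succ ⬝ v₁) ⬝ (signT.closed ⬝ (subT.closed ⬝ v₂ ⬝ (succ ⬝ v₁)))))))

/-- The quotient of `a` by `b`. -/
def divT : Term [] (nat ⇒ nat ⇒ nat) :=
  lam (lam (recursor ⬝ v₁ ⬝ zero ⬝ lam (lam
    (addT.closed ⬝ v₁ ⬝ (isZeroT.closed ⬝ (modT.closed ⬝ (succ ⬝ v₀) ⬝ v₂))))))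

/-- The digit `(s / k ^ a) % k`, for the arguments `k`, `s`, `a`. -/
def digitT : Term [] (nat ⇒ nat ⇒ nat ⇒ nat) :=
  lam (lam (lam (modT.closed ⬝ (divT.closed ⬝ v₁ ⬝ (powT.closed ⬝ v₂ ⬝ v₀)) ⬝ v₂)))

/-- For `n` and a `0`-`1`-valued `g`: the truth value of `∀ i < n, g i = 1`. -/
def ballT : Term [] (nat ⇒ one ⇒ nat) :=
  lam (lam (recursor ⬝ v₁ ⬝ numeral 1 ⬝ lam (lam (mulT.closed ⬝ v₁ ⬝ (v₂ ⬝ v₀)))))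

/-- For `n` and a `0`-`1`-valued `g`: the truth value of `∃ i < n, g i = 1`. -/
def bexT : Term [] (nat ⇒ one ⇒ nat) :=
  lam (lam (recursor ⬝ v₁ ⬝ zero ⬝ lam (lam
    (signT.closed ⬝ (addT.closed ⬝ v₁ ⬝ (v₂ ⬝ v₀))))))

/-- The code of the pair `a < b`: `(0 + 1 + ⋯ + (b - 1)) + a`. -/
def codeT : Term [] (nat ⇒ nat ⇒ nat) :=
  lam (lam (addT.closed ⬝
    (recursor ⬝ v₀ ⬝ zero ⬝ lam (lam (addT.closed ⬝ v₁ ⬝ v₀))) ⬝ v₁))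

/-- For the arguments `e`, `s`, `b`, `a`: the truth value of
"if `(a, b)` is an edge, then the `a`-th and `b`-th base-`k` digits of `s` differ". -/
def properT (k : ℕ) : Term [] (one ⇒ nat ⇒ nat ⇒ nat ⇒ nat) :=
  lam (lam (lam (lam (signT.closed ⬝ (addT.closed ⬝
    (isZeroT.closed ⬝ (v₃ ⬝ (codeT.closed ⬝ v₀ ⬝ v₁))) ⬝
    (addT.closed ⬝
      (subT.closed ⬝ (digitT.closed ⬝ numeral k ⬝ v₂ ⬝ v₀)
        ⬝ (digitT.closed ⬝ numeral k ⬝ v₂ ⬝ v₁)) ⬝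
      (subT.closed ⬝ (digitT.closed ⬝ numeral k ⬝ v₂ ⬝ v₁)
        ⬝ (digitT.closed ⬝ numeral k ⬝ v₂ ⬝ v₀))))))))

/-- The primitive recursive functional `c(G, m)`: for the edge function `e` of `G` and `m`, it is
the truth value (`0` or `1`) of "`G_m` has a `k`-coloring". The `k`-colorings of the vertices
`0, …, m` are represented by the base-`k` digits of the numbers `s < k ^ (m + 1)`. -/
def colorableT (k : ℕ) : Term [] (one ⇒ nat ⇒ nat) :=
  lam (lam (bexT.closed ⬝ (powT.closed ⬝ numeral k ⬝ (succ ⬝ v₀)) ⬝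
    lam (ballT.closed ⬝ (succ ⬝ v₁) ⬝
      lam (ballT.closed ⬝ v₀ ⬝ ((properT k).closed ⬝ v₃ ⬝ v₁ ⬝ v₀)))))

end PrimitiveRecursive

/-! ### The coloring problems, formally -/

/-- `s < t`, as `S s ∸ t = 0`. -/
def lt {Γ : Ctx} (s t : Term Γ nat) : Formula Γ :=
  eq (subT.closed ⬝ (.succ ⬝ s) ⬝ t) .zero

/-- `f` is a `k`-coloring, with colors less than `k`, of the graph with edge function `e`:
`∀ n (f n < k) ∧ ∀ a ∀ b (a < b → e (code a b) ≠ 0 → f a ≠ f b)`. -/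
def isColoring (k : ℕ) {Γ : Ctx} (e f : Term Γ one) : Formula Γ :=
  and (all nat (lt (f.weaken ⬝ .var .here) (numeral k)))
    (all nat (all nat
      (let a : Term (nat :: nat :: Γ) nat := .var (.there .here)
       let b : Term (nat :: nat :: Γ) nat := .var .here
       imp (lt a b)
        (imp (neg (eq (e.weaken.weaken ⬝ (codeT.closed ⬝ a ⬝ b)) .zero))
          (neg (eq (f.weaken.weaken ⬝ a) (f.weaken.weaken ⬝ b)))))))

local notation "x₀" => Term.var Var.here
local notation "x₁" => Term.var (Var.there Var.here)

/-- `GCk`: inputs are the edge functions `e` with `∀ m (c(e, m) = 1)`, and the solutions are the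
`k`-colorings. -/
def GC (k : ℕ) : FormalProblem where
  dom := all nat (eq ((colorableT k).closed ⬝ x₁ ⬝ x₀) (numeral 1))
  sol := isColoring k x₁ x₀

/-- `TGCk`: every edge function `e` is an input, and `f` is a solution if `f 0 = 0` implies that
`f` is a `k`-coloring and `f 0 > 0` implies `c(e, f 0) = 0`. -/
def TGC (k : ℕ) : FormalProblem where
  dom := verum
  sol :=
    and (imp (eq (x₀ ⬝ .zero) .zero) (isColoring k x₁ x₀))
      (imp (lt .zero (x₀ ⬝ .zero)) (eq ((colorableT k).closed ⬝ x₁ ⬝ (x₀ ⬝ .zero)) .zero))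

end IRCA

/-! ### Weihrauch reducibility -/

namespace Weihrauch

/-- The initial segment `⟨x 0, …, x (n - 1)⟩`. -/
def initSeg (x : ℕ → ℕ) (n : ℕ) : List ℕ := (List.range n).map x

/-- A partial function on Baire space is computable if it is the limit of a computable monotone
function on finite sequences: on longer and longer initial segments of an input in the domain,
that function produces longer and longer initial segments of the output. -/
def ComputableFunctional (F : (ℕ → ℕ) →. (ℕ → ℕ)) : Prop :=
  ∃ w : List ℕ → List ℕ, Computable w ∧ (∀ σ τ, σ <+: τ → w σ <+: w τ) ∧
    ∀ x y, y ∈ F x → ∀ n, ∃ m, initSeg y n <+: w (initSeg x m)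

/-- The pairing `⟨x, y⟩(2 n) = x n`, `⟨x, y⟩(2 n + 1) = y n` on Baire space. -/
def pair (x y : ℕ → ℕ) : ℕ → ℕ := fun n => if n % 2 = 0 then x (n / 2) else y (n / 2)

/-- A problem on Baire space: its admissible inputs, and the solutions of an input. -/
structure Problem : Type where
  dom : (ℕ → ℕ) → Prop
  sol : (ℕ → ℕ) → (ℕ → ℕ) → Prop

/-- `Q ≤_W P`. -/
def Reducible (Q P : Problem) : Prop :=
  ∃ Φ Ψ : (ℕ → ℕ) →. (ℕ → ℕ), ComputableFunctional Φ ∧ ComputableFunctional Ψ ∧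
    ∀ u, Q.dom u → ∃ x ∈ Φ u, P.dom x ∧ ∀ y, P.sol x y → ∃ v ∈ Ψ (pair u y), Q.sol u v

/-- `Q <_W P`. -/
def StrictlyReducible (Q P : Problem) : Prop := Reducible Q P ∧ ¬ Reducible P Q

/-- The graph on `ℕ` with edge function `e`: for `a < b`, the pair `(a, b)` has the code
`b (b - 1) / 2 + a`, and it is an edge if and only if `e` is nonzero at that code. -/
def graph (e : ℕ → ℕ) : SimpleGraph ℕ :=
  SimpleGraph.fromRel (fun a b => a < b ∧ e (b * (b - 1) / 2 + a) ≠ 0)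

/-- The finite subgraph `G_m` on the vertices `0, …, m`. -/
abbrev initial (e : ℕ → ℕ) (m : ℕ) : SimpleGraph (Set.Iic m) := (graph e).induce (Set.Iic m)

def IsColoring (k : ℕ) (e f : ℕ → ℕ) : Prop :=
  (∀ n, f n < k) ∧ ∀ a b, (graph e).Adj a b → f a ≠ f b

/-- `k`-coloring of locally `k`-colorable graphs. -/
def GC (k : ℕ) : Problem where
  dom e := ∀ m, (initial e m).Colorable k
  sol e f := IsColoring k e f

/-- Total `k`-coloring of graphs. -/
def TGC (k : ℕ) : Problem where
  dom _ := True
  sol e f := (f 0 = 0 → IsColoring k e f) ∧ (0 < f 0 → ¬ (initial e (f 0)).Colorable k)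

end Weihrauch

/-! In both settings the forward reduction is essentially the identity. If every `G_m` is
`k`-colorable and `f` solves `TGC k` for `G`, then `f 0 > 0` would name a finite subgraph without a
`k`-coloring, so `f 0 = 0` and `f` itself is a coloring. Formally this needs two things: that `f 0 =
0 ∨ 0 < f 0` holds intuitionistically (`zero_or_pos`, by quantifier-free induction), and that the
combinatory identity, only provably equal to the identity, can be removed by extensionality
(`isColoring_identity`). The term for colorability is never evaluated.

Strictness (`TGC_not_reducible_GC`) is a continuity argument. On the empty graph, a reduction of
`TGC k` to `GC k` must answer `0` for every coloring of the produced graph `x`. By compactness of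
the space of color sequences, one `n` suffices for it to do so from the first `n` entries, for every
`y` proper on the vertices below `n`. Now add edges beyond everything read so far, so that an
infinite clique appears. The new graph produced by the reduction still has a coloring, and agrees
with `x` below `n`, so the answer is again `0`: it claims a coloring of a graph that has none. -/

namespace IRCA

open FType Formula

local infixr:60 " ⇒ " => FType.arrow
local infixl:70 " ⬝ " => Term.app
local notation "v₀" => Term.var Var.here
local notation "v₁" => Term.var (Var.there Var.here)

/-! ### Substitution -/

theorem Term.subst_subst {Γ Δ Ξ : Ctx} (θ : Sub Γ Δ) (η : Sub Δ Ξ) {τ : FType} (t : Term Γ τ) :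
    (t.subst θ).subst η = t.subst fun _ x => (θ _ x).subst η := by
  induction t with
  | app f a hf ha => simp only [subst, hf, ha]
  | _ => rfl

theorem Term.subst_var {Γ : Ctx} {τ : FType} (t : Term Γ τ) :
    t.subst (fun _ x => .var x) = t := by
  induction t with
  | app f a hf ha => simp only [subst, hf, ha]
  | _ => rfl

@[simp] theorem Term.weaken_subst_single {Γ : Ctx} {σ τ : FType} (t : Term Γ τ) (a : Term Γ σ) :
    t.weaken.subst (Sub.single a) = t :=
  (t.subst_subst _ _).trans t.subst_var

@[simp] theorem Term.weaken_subst_lift {Γ Δ : Ctx} (θ : Sub Γ Δ) {σ τ : FType} (t : Term Γ τ) :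
    t.weaken.subst (θ.lift σ) = (t.subst θ).weaken := by
  rw [weaken, weaken, subst_subst, subst_subst]
  rfl

@[simp] theorem Term.closed_subst {Γ Δ : Ctx} (θ : Sub Γ Δ) {τ : FType} (t : Term [] τ) :
    t.closed.subst θ = t.closed := by
  refine (t.subst_subst _ _).trans ?_
  unfold closed
  congr 1
  funext τ x
  cases x

@[simp] theorem numeral_subst {Γ Δ : Ctx} (θ : Sub Γ Δ) (n : ℕ) :
    (numeral n).subst θ = numeral n := by
  induction n with
  | zero => rfl
  | succ n ih => simp only [numeral, Term.subst, ih]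

@[simp] theorem Sub.single_here {Γ : Ctx} {σ : FType} (a : Term Γ σ) :
    Sub.single a σ .here = a := rfl

@[simp] theorem Sub.single_there {Γ : Ctx} {σ τ : FType} (a : Term Γ σ) (x : Var Γ τ) :
    Sub.single a τ (.there x) = .var x := rfl

@[simp] theorem Sub.cons_here {Γ Δ : Ctx} {σ : FType} (t : Term Δ σ) (θ : Sub Γ Δ) :
    Sub.cons t θ σ .here = t := rfl

@[simp] theorem Sub.cons_there {Γ Δ : Ctx} {σ τ : FType} (t : Term Δ σ) (θ : Sub Γ Δ)
    (x : Var Γ τ) : Sub.cons t θ τ (.there x) = θ τ x := rfl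

@[simp] theorem Sub.lift_here {Γ Δ : Ctx} (θ : Sub Γ Δ) (σ : FType) :
    θ.lift σ σ .here = .var .here := rfl

@[simp] theorem Sub.lift_there {Γ Δ : Ctx} (θ : Sub Γ Δ) (σ : FType) {τ : FType} (x : Var Γ τ) :
    θ.lift σ τ (.there x) = (θ τ x).weaken := rfl

@[simp] theorem Sub.weaken_apply {Γ : Ctx} {σ τ : FType} (x : Var Γ τ) :
    Sub.weaken Γ σ τ x = .var (.there x) := rfl

@[simp] theorem Sub.step_here {Γ : Ctx} :
    Sub.step Γ nat .here = .succ ⬝ v₀ := rfl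

@[simp] theorem Sub.two_here {Γ : Ctx} {σ τ : FType} (x : Term Γ σ) (y : Term Γ τ) :
    Sub.two x y τ .here = y := rfl

@[simp] theorem Sub.two_there {Γ : Ctx} {σ τ : FType} (x : Term Γ σ) (y : Term Γ τ) :
    Sub.two x y σ (.there .here) = x := rfl

@[simp] theorem Sub.one_here {Γ : Ctx} {σ : FType} (x : Term Γ σ) :
    Sub.one x σ .here = x := rfl

attribute [simp] Term.subst Formula.subst

@[simp] theorem Formula.eqAt_subst {Γ Δ : Ctx} (θ : Sub Γ Δ) {τ : FType} (s t : Term Γ τ) :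
    (eqAt τ s t).subst θ = eqAt τ (s.subst θ) (t.subst θ) := by
  induction τ generalizing Γ Δ with
  | nat => rfl
  | arrow σ τ _ ih => simp [eqAt, ih]

@[simp] theorem lt_subst {Γ Δ : Ctx} (θ : Sub Γ Δ) (s t : Term Γ nat) :
    (lt s t).subst θ = lt (s.subst θ) (t.subst θ) := by
  simp [lt]

theorem isColoring_subst (k : ℕ) {Γ Δ : Ctx} (θ : Sub Γ Δ) (e f : Term Γ one) :
    (isColoring k e f).subst θ = isColoring k (e.subst θ) (f.subst θ) := by
  simp [isColoring]

/-! ### Equality at higher types -/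

namespace Deriv

theorem eqAt_refl {τ : FType} {Γ : Ctx} {H : List (Formula Γ)} (t : Term Γ τ) :
    Deriv H (eqAt τ t t) := by
  induction τ generalizing Γ with
  | nat => exact post (.eqRefl t)
  | arrow σ τ _ ih => exact allIntro (ih _)

theorem allElim_eqAt {σ τ : FType} {Γ : Ctx} {H : List (Formula Γ)} {s t : Term Γ (σ ⇒ τ)}
    (h : Deriv H (eqAt (σ ⇒ τ) s t)) (a : Term Γ σ) : Deriv H (eqAt τ (s ⬝ a) (t ⬝ a)) := by
  simpa [Formula.inst] using allElim h a

theorem hyp_weaken {σ : FType} {Γ : Ctx} {H : List (Formula Γ)} {φ : Formula Γ} (h : φ ∈ H) :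
    Deriv (H.map (Formula.weaken (σ := σ))) φ.weaken :=
  hyp (List.mem_map_of_mem h)

theorem eqAt_symm_imp {τ : FType} {Γ : Ctx} {H : List (Formula Γ)} (s t : Term Γ τ) :
    Deriv H (imp (eqAt τ s t) (eqAt τ t s)) := by
  induction τ generalizing Γ with
  | nat => exact post (.eqSymm s t)
  | arrow σ τ _ ih =>
    refine impIntro (allIntro (impElim (ih _ _) (allElim_eqAt ?_ v₀)))
    rw [← eqAt_subst]
    exact hyp_weaken (List.mem_cons_self ..)

/-- As for symmetry, the implication form keeps the premises among the open assumptions, where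
`hyp_weaken` carries them under the new variable; derivations themselves need no weakening lemma. -/
theorem eqAt_trans_imp {τ : FType} {Γ : Ctx} {H : List (Formula Γ)} (r s t : Term Γ τ) :
    Deriv H (imp (eqAt τ r s) (imp (eqAt τ s t) (eqAt τ r t))) := by
  induction τ generalizing Γ with
  | nat => exact post (.eqTrans r s t)
  | arrow σ τ _ ih =>
    refine impIntro (impIntro (allIntro (impElim (impElim (ih _ (s.weaken ⬝ v₀) _)
      (allElim_eqAt ?_ v₀)) (allElim_eqAt ?_ v₀))))
    · rw [← eqAt_subst]
      exact hyp_weaken (by simp)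
    · rw [← eqAt_subst]
      exact hyp_weaken (by simp)

variable {Γ : Ctx} {H : List (Formula Γ)}

theorem eqAt_symm {τ : FType} {s t : Term Γ τ} (h : Deriv H (eqAt τ s t)) :
    Deriv H (eqAt τ t s) :=
  impElim (eqAt_symm_imp s t) h

theorem eqAt_trans {τ : FType} {r s t : Term Γ τ} (h : Deriv H (eqAt τ r s))
    (h' : Deriv H (eqAt τ s t)) : Deriv H (eqAt τ r t) :=
  impElim (impElim (eqAt_trans_imp r s t) h) h'

theorem eqAt_app {σ τ : FType} {f g : Term Γ (σ ⇒ τ)} {a b : Term Γ σ}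
    (hf : Deriv H (eqAt (σ ⇒ τ) f g)) (ha : Deriv H (eqAt σ a b)) :
    Deriv H (eqAt τ (f ⬝ a) (g ⬝ b)) :=
  eqAt_trans (impElim (post (.ext f a b)) ha) (allElim_eqAt hf b)

theorem eqAt_arg {σ τ : FType} (f : Term Γ (σ ⇒ τ)) {a b : Term Γ σ}
    (ha : Deriv H (eqAt σ a b)) : Deriv H (eqAt τ (f ⬝ a) (f ⬝ b)) :=
  impElim (post (.ext f a b)) ha

/-- β-conversion for the combinatory abstraction, under a substitution `θ`. -/
theorem beta {Δ : Ctx} {σ τ : FType} (t : Term (σ :: Δ) τ) (θ : Sub Δ Γ) (a : Term Γ σ) :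
    Deriv H (eqAt τ (t.lam.subst θ ⬝ a) (t.subst (Sub.cons a θ))) := by
  induction t with
  | var x =>
    cases x with
    -- The identity is `S K K`, and `S K K a = K a (K a) = a`.
    | here => exact eqAt_trans (post (.combS _ _ _)) (post (.combK _ _))
    | there x => exact post (.combK _ _)
  | app f b hf hb => exact eqAt_trans (post (.combS _ _ _)) (eqAt_app hf hb)
  | _ => exact post (.combK _ _)

theorem beta₂ {Δ : Ctx} {ρ σ τ : FType} (t : Term (σ :: ρ :: Δ) τ) (θ : Sub Δ Γ)
    (a : Term Γ ρ) (b : Term Γ σ) :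
    Deriv H (eqAt τ (t.lam.lam.subst θ ⬝ a ⬝ b) (t.subst (Sub.cons b (Sub.cons a θ)))) :=
  eqAt_trans (allElim_eqAt (beta t.lam θ a) b) (beta t _ b)

/-! ### Arithmetic -/

/-- A closed term is a substitution instance of a combinatory abstraction, so `beta` applies to it
by definitional unfolding. -/
theorem predT_zero : Deriv H (eq (predT.closed ⬝ .zero) .zero) :=
  eqAt_trans (τ := nat) (beta _ _ _) (post (.recZero _ _))

theorem predT_succ (t : Term Γ nat) : Deriv H (eq (predT.closed ⬝ (.succ ⬝ t)) t) :=
  eqAt_trans (τ := nat) (beta _ _ _)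
    (eqAt_trans (τ := nat) (post (.recSucc _ _ _)) (beta₂ _ _ _ _))

theorem subT_eq (s t : Term Γ nat) : Deriv H (eqAt nat (subT.closed ⬝ s ⬝ t)
    (.recursor ⬝ t ⬝ s ⬝ (Term.lam (.lam (predT.closed ⬝ v₁))).closed)) :=
  beta₂ _ _ s t

theorem subT_zero (s : Term Γ nat) : Deriv H (eq (subT.closed ⬝ s ⬝ .zero) s) :=
  eqAt_trans (τ := nat) (subT_eq s .zero) (post (.recZero _ _))

theorem subT_succ (s t : Term Γ nat) : Deriv H (eq (subT.closed ⬝ s ⬝ (.succ ⬝ t))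
    (predT.closed ⬝ (subT.closed ⬝ s ⬝ t))) := by
  refine eqAt_trans (τ := nat) (subT_eq s _) (eqAt_trans (τ := nat) (post (.recSucc _ _ _)) ?_)
  refine eqAt_trans (τ := nat) (beta₂ _ _ _ _) ?_
  simpa using eqAt_arg predT.closed (eqAt_symm (τ := nat) (subT_eq s t))

/-- Induction step for `zero_or_pos`: `1 ∸ S t` is the predecessor of `1 ∸ t`, which is `1` if `t =
0` and `0` if `0 < t`. -/
theorem zero_lt_succ (t : Term Γ nat)
    (h : Deriv H (or (eq t .zero) (lt .zero t))) : Deriv H (lt .zero (.succ ⬝ t)) := by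
  refine eqAt_trans (τ := nat) (subT_succ _ _) (orElim h ?_ ?_)
  · have h' : Deriv (eq t .zero :: H) (eqAt nat t .zero) := hyp (List.mem_cons_self ..)
    exact eqAt_trans (τ := nat) (eqAt_arg _ (eqAt_trans (eqAt_arg _ h') (subT_zero _)))
      (predT_succ _)
  · have h' : Deriv (lt .zero t :: H) (eqAt nat (subT.closed ⬝ (.succ ⬝ .zero) ⬝ t) .zero) :=
      hyp (List.mem_cons_self ..)
    exact eqAt_trans (τ := nat) (eqAt_arg _ h') predT_zero

theorem zero_or_pos (t : Term Γ nat) : Deriv H (or (eq t .zero) (lt .zero t)) := by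
  have h := post (H := H) (.induction (or (eq v₀ .zero) (lt .zero v₀)) ⟨trivial, trivial⟩)
  simpa [Formula.inst] using allElim (impElim h (andIntro
    (by simpa [Formula.inst] using orInl (post (.eqRefl .zero)))
    (allIntro (impIntro (by
      simpa using orInr (zero_lt_succ _ (hyp (List.mem_cons_self ..)))))))) t

theorem not_eq_one_of_eq_zero {t : Term Γ nat} (h₁ : Deriv H (eq t (numeral 1)))
    (h₀ : Deriv H (eq t .zero)) : Deriv H falsum :=
  impElim (post (.succNeZero .zero))
    (eqAt_trans (τ := nat) (eqAt_symm (τ := nat) h₁) h₀)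

end Deriv

/-! ### The reduction -/

/-- The identity functional on type `1`. -/
def identity {Γ : Ctx} : Term Γ (one ⇒ one) := Term.lam v₀

@[simp] theorem identity_subst {Γ Δ : Ctx} (θ : Sub Γ Δ) :
    (identity : Term Γ (one ⇒ one)).subst θ = identity := rfl

namespace Deriv

variable {Γ : Ctx} {H : List (Formula Γ)}

theorem identity_eq (t : Term Γ one) : Deriv H (eqAt one (identity ⬝ t) t) :=
  beta v₀ (fun _ x => .var x) t

theorem identity_app (t : Term Γ one) (n : Term Γ nat) :
    Deriv H (eqAt nat (identity ⬝ t ⬝ n) (t ⬝ n)) :=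
  allElim_eqAt (identity_eq t) n

/-- The premise is an open assumption rather than a derivation, so that it can be carried under the
quantifiers of the conclusion. -/
theorem isColoring_identity {k : ℕ} {e f : Term Γ one}
    (h : isColoring k (identity ⬝ e) f ∈ H) : Deriv H (isColoring k e (identity ⬝ f)) := by
  have hw : ∀ {σ : FType} {Γ : Ctx} {H : List (Formula Γ)} {e f : Term Γ one},
      isColoring k (identity ⬝ e) f ∈ H →
      isColoring k (identity ⬝ e.weaken) f.weaken ∈ H.map (Formula.weaken (σ := σ)) := by
    intro σ Γ H e f h
    have := List.mem_map_of_mem (f := Formula.weaken (σ := σ)) h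
    rwa [Formula.weaken, isColoring_subst] at this
  refine andIntro (allIntro ?_) (allIntro (allIntro (impIntro (impIntro (impIntro ?_)))))
  · have h' := allElim (andLeft (hyp (hw (σ := nat) h))) v₀
    simp [Formula.inst] at h'
    refine eqAt_trans (τ := nat) (eqAt_app (eqAt_arg _ (eqAt_arg _ ?_)) (eqAt_refl _)) h'
    simpa using identity_app _ _
  · refine impElim (impElim (impElim (?_ : Deriv _ (imp (lt v₁ v₀) (imp
      (neg (eq (identity ⬝ e.weaken.weaken ⬝ (codeT.closed ⬝ v₁ ⬝ v₀)) .zero))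
      (neg (eq (f.weaken.weaken ⬝ v₁) (f.weaken.weaken ⬝ v₀)))))) (hyp (by simp)))
      (impIntro (impElim (hyp (List.mem_cons_of_mem _ (List.mem_cons_of_mem _
        (List.mem_cons_self ..)))) ?_))) ?_
    · simpa [Formula.inst] using allElim (allElim (andRight (hyp (List.mem_cons_of_mem _
        (List.mem_cons_of_mem _ (List.mem_cons_of_mem _ (hw (σ := nat) (hw (σ := nat) h)))))))
        v₁) v₀
    · exact eqAt_trans (eqAt_symm (identity_app _ _)) (hyp (List.mem_cons_self ..))
    · exact eqAt_trans (eqAt_symm (identity_app _ _))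
        (eqAt_trans (hyp (List.mem_cons_self ..)) (identity_app _ _))

end Deriv

theorem provable_reduction_GC_TGC (k : ℕ) : Provable (reduction (GC k) (TGC k)) := by
  refine .exIntro identity (.exIntro identity (.allIntro (.allIntro (.impIntro ?_))))
  refine .andIntro (.impIntro (.hyp (List.mem_cons_self ..))) (.impIntro ?_)
  simp only [TGC, subst, Term.subst, Sub.two_here, isColoring_subst, Sub.two_there, lt_subst,
    Term.closed_subst, Sub.lift_here, Sub.lift_there, Sub.single_here, identity_subst,
    Sub.weaken_apply, GC, Sub.one_here, numeral_subst, List.map_nil]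
  refine .orElim (Deriv.zero_or_pos (v₀ ⬝ .zero)) ?_ (.falsumElim
    (Deriv.not_eq_one_of_eq_zero (t := (colorableT k).closed ⬝ v₁ ⬝ (v₀ ⬝ .zero)) ?_ ?_))
  -- A cut turns the derived coloring statement into an open assumption, as `isColoring_identity`
  -- requires.
  · exact .impElim (.impIntro (Deriv.isColoring_identity (List.mem_cons_self ..)))
      (.impElim (.andLeft (.hyp (List.mem_cons_of_mem _ (List.mem_cons_self ..))))
        (.hyp (List.mem_cons_self ..)))
  · simpa [Formula.inst] using Deriv.allElim (σ := nat)
      (φ := eq ((colorableT k).closed ⬝ .var (.there (.there .here)) ⬝ v₀) (numeral 1))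
      (.hyp (List.mem_cons_of_mem _ (List.mem_cons_of_mem _ (List.mem_cons_self ..))))
      (v₀ ⬝ .zero)
  -- Extensionality at type `1` replaces `e` by `identity ⬝ e` inside the colorability term.
  · exact Deriv.eqAt_trans (τ := nat)
      (Deriv.allElim_eqAt (Deriv.eqAt_arg _ (Deriv.eqAt_symm (Deriv.identity_eq _))) _)
      (.impElim (.andRight (.hyp (List.mem_cons_of_mem _ (List.mem_cons_self ..))))
        (.hyp (List.mem_cons_self ..)))

end IRCA

/-! ### Initial segments and the reduction on Baire space -/

namespace Weihrauch

theorem initSeg_congr {x y : ℕ → ℕ} {n : ℕ} (h : ∀ i < n, x i = y i) :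
    initSeg x n = initSeg y n :=
  List.map_congr_left fun i hi => h i (List.mem_range.1 hi)

@[simp] theorem length_initSeg (x : ℕ → ℕ) (n : ℕ) : (initSeg x n).length = n := by
  simp [initSeg]

@[simp] theorem getElem_initSeg (x : ℕ → ℕ) (n i : ℕ) (h : i < (initSeg x n).length) :
    (initSeg x n)[i] = x i := by
  simp [initSeg]

theorem initSeg_prefix (x : ℕ → ℕ) {m n : ℕ} (h : m ≤ n) : initSeg x m <+: initSeg x n := by
  rw [List.prefix_iff_eq_take]
  apply List.ext_getElem
  · simp [h]
  · intro i h₁ h₂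
    simp

theorem computableFunctional_id : ComputableFunctional (fun x => Part.some x) :=
  ⟨id, Computable.id, fun _ _ h => h, fun x y h n => ⟨n, by
    rw [Part.mem_some_iff] at h
    simp [h]⟩⟩

/-- The entries of a list at the odd positions. -/
def oddEntries (σ : List ℕ) : List ℕ :=
  (List.range (σ.length / 2)).map fun i => σ.getD (2 * i + 1) 0

theorem computable_oddEntries : Computable oddEntries := by
  apply Primrec.to_comp
  refine Primrec.list_map (Primrec.list_range.comp
    (Primrec.nat_div.comp Primrec.list_length (Primrec.const 2))) ?_
  refine (Primrec.list_getD 0).comp Primrec.fst ?_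
  exact Primrec.succ.comp (Primrec.nat_mul.comp (Primrec.const 2) Primrec.snd)

theorem oddEntries_prefix {σ τ : List ℕ} (h : σ <+: τ) : oddEntries σ <+: oddEntries τ := by
  obtain ⟨ρ, rfl⟩ := h
  rw [List.prefix_iff_eq_take]
  apply List.ext_getElem
  · simp only [oddEntries, List.length_map, List.length_range, List.length_take,
      List.length_append]
    omega
  · intro i h₁ h₂
    simp only [oddEntries, List.length_map, List.length_range] at h₁
    simp only [oddEntries, List.getElem_map, List.getElem_range, List.getElem_take]
    -- The default `0` is never reached: `i < σ.length / 2` gives `2 * i + 1 < σ.length`.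
    rw [List.getD_append _ _ _ _ (by omega)]

theorem computableFunctional_odd :
    ComputableFunctional (fun x => Part.some fun n => x (2 * n + 1)) := by
  refine ⟨oddEntries, computable_oddEntries, fun _ _ h => oddEntries_prefix h,
    fun x y h n => ⟨2 * n, ?_⟩⟩
  rw [Part.mem_some_iff] at h
  subst h
  rw [List.prefix_iff_eq_take]
  apply List.ext_getElem
  · simp [oddEntries]
  · intro i h₁ h₂
    rw [length_initSeg] at h₁
    simp only [oddEntries, List.getElem_map, List.getElem_range, List.getElem_take,
      getElem_initSeg]
    rw [List.getD_eq_getElem _ _ (by rw [length_initSeg]; omega), getElem_initSeg]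

theorem pair_odd (x y : ℕ → ℕ) : (fun n => pair x y (2 * n + 1)) = y := by
  funext n
  have h₂ : (2 * n + 1) / 2 = n := by omega
  simp [pair, h₂]

theorem pair_congr {x x' y y' : ℕ → ℕ} {n : ℕ} (hx : ∀ i < n, x i = x' i)
    (hy : ∀ i < n, y i = y' i) : ∀ i < n, pair x y i = pair x' y' i := by
  intro i hi
  unfold pair
  split_ifs
  · exact hx _ (by omega)
  · exact hy _ (by omega)

theorem GC_reducible_TGC (k : ℕ) : Reducible (GC k) (TGC k) := by
  refine ⟨_, _, computableFunctional_id, computableFunctional_odd, fun u hu =>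
    ⟨u, Part.mem_some u, trivial, fun y hy => ⟨y, ?_, ?_⟩⟩⟩
  · rw [pair_odd]
    exact Part.mem_some y
  · rcases Nat.eq_zero_or_pos (y 0) with h | h
    · exact hy.1 h
    · exact absurd (hu _) (hy.2 h)

/-! ### Compactness and infinite colorings -/

/-- Compactness of the space of sequences of colors. -/
theorem exists_forall_of_finitely_determined {k : ℕ} (P : ℕ → (ℕ → Fin k) → Prop)
    (hP : ∀ n y z, (∀ i < n, y i = z i) → P n y → P n z)
    (hmono : ∀ n y, P (n + 1) y → P n y) (hne : ∀ n, ∃ y, P n y) : ∃ y, ∀ n, P n y := by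
  have hclosed : ∀ n, IsClosed {y | P n y} := by
    intro n
    let r : (ℕ → Fin k) → (Fin n → Fin k) := fun y i => y i
    have hr : Continuous r := by fun_prop
    -- A condition on the first `n` coordinates is the preimage of a subset of a discrete space.
    have heq : {y | P n y} = r ⁻¹' (r '' {y | P n y}) := by
      refine (Set.subset_preimage_image r _).antisymm ?_
      rintro z ⟨y, hy, hyz⟩
      exact hP n y z (fun i hi => congrFun hyz ⟨i, hi⟩) hy
    rw [heq]
    exact (isClosed_discrete _).preimage hr
  obtain ⟨y, hy⟩ := IsCompact.nonempty_iInter_of_sequence_nonempty_isCompact_isClosed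
    (fun n => {y | P n y}) hmono hne (hclosed 0).isCompact hclosed
  exact ⟨y, fun n => Set.mem_iInter.1 hy n⟩

/-- The de Bruijn–Erdős theorem for graphs on `ℕ`: stage `n` of the compactness argument asks for
properness below `n`. -/
theorem exists_isColoring_of_locally_colorable {k : ℕ} {e : ℕ → ℕ}
    (he : ∀ m, (initial e m).Colorable k) : ∃ y : ℕ → Fin k, IsColoring k e fun n => y n := by
  obtain ⟨y, hy⟩ := exists_forall_of_finitely_determined
    (fun n (y : ℕ → Fin k) => ∀ a < n, ∀ b < n, (graph e).Adj a b → y a ≠ y b)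
    (fun n y z h hy a ha b hb hab => h a ha ▸ h b hb ▸ hy a ha b hb hab)
    (fun n y hy a ha b hb => hy a (by omega) b (by omega))
    (fun n => by
      obtain ⟨c⟩ := he n
      -- The filler color beyond `n` is that of vertex `0`, which always exists, so `k > 0` need not
      -- be assumed.
      refine ⟨fun a => if h : a ≤ n then c ⟨a, h⟩ else c ⟨0, Nat.zero_le n⟩, ?_⟩
      intro a ha b hb hab
      simp only [ha.le, hb.le, dif_pos]
      exact c.valid hab)
  refine ⟨y, fun n => (y n).2, fun a b hab h => ?_⟩
  exact hy (max a b + 1) a (by omega) b (by omega) hab (Fin.ext h)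

/-! ### Finite dependence and the failure of the converse reduction -/

theorem graph_adj_congr {e e' : ℕ → ℕ} {n a b : ℕ} (h : ∀ i < n * n, e i = e' i)
    (ha : a < n) (hb : b < n) (hab : (graph e).Adj a b) : (graph e').Adj a b := by
  -- Crude bound: the codes of pairs below `n` lie below `n * n`.
  have key : ∀ a b, a < b → b < n → e (b * (b - 1) / 2 + a) = e' (b * (b - 1) / 2 + a) := by
    intro a b hab hb
    apply h
    have h₁ : b * (b - 1) / 2 ≤ b * (b - 1) := Nat.div_le_self _ _
    obtain ⟨c, rfl⟩ : ∃ c, b = c + 1 := ⟨b - 1, by omega⟩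
    rw [Nat.add_sub_cancel] at h₁ ⊢
    nlinarith
  simp only [graph, SimpleGraph.fromRel_adj] at hab ⊢
  refine ⟨hab.1, hab.2.imp (fun h' => ⟨h'.1, ?_⟩) (fun h' => ⟨h'.1, ?_⟩)⟩
  · exact key a b h'.1 hb ▸ h'.2
  · exact key b a h'.1 ha ▸ h'.2

/-- A graph whose edge function is eventually nonzero contains an infinite clique. -/
theorem not_isColoring_of_eventually_ne_zero {k L : ℕ} {e : ℕ → ℕ} (he : ∀ i, L ≤ i → e i ≠ 0)
    (f : ℕ → ℕ) : ¬ IsColoring k e f := by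
  rintro ⟨hf, hadj⟩
  have hinj : Function.Injective fun n : ℕ => (⟨f (n + L), hf _⟩ : Fin k) := by
    have key : ∀ a b, a < b → f (a + L) ≠ f (b + L) := by
      intro a b hab
      refine hadj _ _ ?_
      simp only [graph, SimpleGraph.fromRel_adj]
      -- The code of a pair is at least its smaller entry, here at least `L`.
      exact ⟨by omega, Or.inl ⟨by omega, he _ (by omega)⟩⟩
    intro a b hab
    have hab' : f (a + L) = f (b + L) := congrArg Fin.val hab
    rcases lt_trichotomy a b with h | h | h
    · exact absurd hab' (key a b h)
    · exact h
    · exact absurd hab'.symm (key b a h)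
  exact not_injective_infinite_finite _ hinj

theorem initial_zero_colorable {k : ℕ} (hk : 0 < k) (m : ℕ) :
    (initial (fun _ => 0) m).Colorable k :=
  ⟨SimpleGraph.Coloring.mk (fun _ => (⟨0, hk⟩ : Fin k)) fun {a b} hab => by
    simp [graph] at hab⟩

theorem TGC_not_reducible_GC {k : ℕ} (hk : 0 < k) : ¬ Reducible (TGC k) (GC k) := by
  rintro ⟨Φ, Ψ, ⟨w, -, hw, hΦ⟩, ⟨w', -, hw', hΨ⟩, hred⟩
  obtain ⟨x, hx, hxdom, hxsol⟩ := hred (fun _ => 0) trivial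
  -- Otherwise compactness yields a coloring of `x` on which `w'` never outputs a leading `0`,
  -- although that answer is forced on the empty graph.
  have hbar : ∃ n, ∀ y : ℕ → Fin k, (∀ a < n, ∀ b < n, (graph x).Adj a b → y a ≠ y b) →
      [0] <+: w' (initSeg (pair (fun _ => 0) fun i => y i) n) := by
    by_contra! hcon
    obtain ⟨y, hy⟩ := exists_forall_of_finitely_determined
      (fun n (y : ℕ → Fin k) => (∀ a < n, ∀ b < n, (graph x).Adj a b → y a ≠ y b) ∧
        ¬ [0] <+: w' (initSeg (pair (fun _ => 0) fun i => y i) n))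
      (fun n y z h hy => ⟨fun a ha b hb hab => h a ha ▸ h b hb ▸ hy.1 a ha b hb hab, by
        rw [← initSeg_congr (pair_congr (fun _ _ => rfl)
          (fun i hi => congrArg Fin.val (h i hi)))]
        exact hy.2⟩)
      (fun n y hy => ⟨fun a ha b hb => hy.1 a (by omega) b (by omega), fun h =>
        hy.2 (h.trans (hw' _ _ (initSeg_prefix _ n.le_succ)))⟩)
      hcon
    obtain ⟨v, hv, hvsol⟩ := hxsol (fun i => y i) ⟨fun n => (y n).2, fun a b hab h =>
      (hy (max a b + 1)).1 a (by omega) b (by omega) hab (Fin.ext h)⟩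
    have hv0 : v 0 = 0 := by
      by_contra h
      exact hvsol.2 (Nat.pos_of_ne_zero h) (initial_zero_colorable hk _)
    obtain ⟨m, hm⟩ := hΨ _ _ hv 1
    have hm' : [0] <+: w' (initSeg (pair (fun _ => 0) fun i => y i) m) := by
      simpa [initSeg, hv0] using hm
    exact (hy m).2 hm'
  obtain ⟨n, hn⟩ := hbar
  obtain ⟨M, hM⟩ := hΦ _ _ hx (n * n)
  -- Below `M` agreement with the empty graph fixes the produced graph on codes below `n * n`; below
  -- `n` it fixes what `w'` reads.
  let u : ℕ → ℕ := fun i => if i < max M n then 0 else 1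
  have hu : ∀ i < max M n, (0 : ℕ) = u i := fun i hi => (if_pos hi).symm
  obtain ⟨x', hx', hxdom', hxsol'⟩ := hred u trivial
  obtain ⟨M', hM'⟩ := hΦ _ _ hx' (n * n)
  -- Both segments are prefixes of one value of `w` on `u`, by monotonicity, and have equal length.
  have hxx' : ∀ i < n * n, x' i = x i := by
    rw [initSeg_congr (y := u) fun i hi => hu i (by omega)] at hM
    have h := List.prefix_of_prefix_length_le
      (hM'.trans (hw _ _ (initSeg_prefix u (le_max_right M M'))))
      (hM.trans (hw _ _ (initSeg_prefix u (le_max_left M M')))) (by simp)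
    have h' := h.eq_of_length (by simp)
    intro i hi
    have := List.getElem_of_eq h' (i := i) (by simpa using hi)
    simpa using this
  obtain ⟨y, hy⟩ := exists_isColoring_of_locally_colorable hxdom'
  obtain ⟨v, hv, hvsol⟩ := hxsol' _ hy
  -- `y` colors `x'`, hence is proper for `x` below `n`, so the uniform bound applies to it.
  have h0 := hn y fun a ha b hb hab h =>
    hy.2 a b (graph_adj_congr (fun i hi => (hxx' i hi).symm) ha hb hab) (congrArg Fin.val h)
  rw [initSeg_congr (pair_congr (fun i hi => hu i (by omega)) (fun _ _ => rfl))] at h0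
  obtain ⟨m, hm⟩ := hΨ _ _ hv 1
  have h := List.prefix_of_prefix_length_le
    (hm.trans (hw' _ _ (initSeg_prefix _ (le_max_right n m))))
    (h0.trans (hw' _ _ (initSeg_prefix _ (le_max_left n m)))) (by simp)
  have hv0 : v 0 = 0 := by simpa [initSeg] using h.eq_of_length (by simp)
  refine not_isColoring_of_eventually_ne_zero (L := max M n) (fun i hi => ?_) v (hvsol.1 hv0)
  rw [show u i = 1 from if_neg (not_lt.2 hi)]
  exact one_ne_zero

end Weihrauch

theorem mainTheorem8 (k : ℕ) (hk : 2 ≤ k) :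
    IRCA.Provable (IRCA.reduction (IRCA.GC k) (IRCA.TGC k)) ∧
      Weihrauch.StrictlyReducible (Weihrauch.GC k) (Weihrauch.TGC k) :=
  ⟨IRCA.provable_reduction_GC_TGC k, Weihrauch.GC_reducible_TGC k,
    Weihrauch.TGC_not_reducible_GC (by omega)⟩
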